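/- Let $n_1,n_2,n_3$ be non-zero real numbers and consider, on $\mathbb R^6$ with coordinates $(Q,p)=(Q^1,Q^2,Q^3,p_1,p_2,p_3)$ and the standard symplectic structure, the Bianchi class A Hamiltonian $$ \mathcal H(p,Q)=2\sum_{i<j}p_ip_j-\sum_{i=1}^3p_i^2+\frac14\Big(2\sum_{i<j}n_in_j\,e^{Q^i+Q^j}-\sum_{i=1}^3n_i^2\,e^{2Q^i}\Big). $$ Then the Hamiltonian system of $\mathcal H$ is not integrable in the sense of Birkhoff: there do not exist three first integrals $F_1,F_2,F_3$, with differentials linearly independent at some point, each of which is of the form $$ F(Q,p)=\sum_{k\in\mathbb Z_{\ge0}^3,\ |k|\le l}f_k(Q)\,p_1^{k_1}p_2^{k_2}p_3^{k_3},\qquad f_k(Q)=\sum_{m\in\mathbb Z^3}f^{(k)}_m\,e^{\langle c^{(k)}_m,Q\rangle}, $$ with $l\ge 0$, real constants $f^{(k)}_m$, vectors $c^{(k)}_m\in\mathbb R^3$, and absolutely convergent series. This holds whether the integrals are required on all of $\mathbb R^6$ or only on $U\times\mathbb R^3$ for some open set $U\subseteq\mathbb R^3$ of values of $Q$. -/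

import Mathlib

namespace BirkhoffInt

/-- Phase space `ℝ²ⁿ` with the standard symplectic structure; a point is a pair `(q, p)`. -/
abbrev Phase (n : ℕ) : Type := (Fin n → ℝ) × (Fin n → ℝ)

/-- `{f, g} = ∑ᵢ (∂f/∂qᵢ ∂g/∂pᵢ - ∂f/∂pᵢ ∂g/∂qᵢ)`. -/
noncomputable def poissonBracket {n : ℕ} (f g : Phase n → ℝ) (z : Phase n) : ℝ :=
  ∑ i, (fderiv ℝ f z (Pi.single i 1, 0) * fderiv ℝ g z (0, Pi.single i 1)
    - fderiv ℝ f z (0, Pi.single i 1) * fderiv ℝ g z (Pi.single i 1, 0))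

/-- `f` is a first integral, on the part `D` of the phase space, of Hamilton's equations
`q' = ∂H/∂p`, `p' = -∂H/∂q`. -/
def IsFirstIntegralOn {n : ℕ} (H f : Phase n → ℝ) (D : Set (Phase n)) : Prop :=
  DifferentiableOn ℝ f D ∧ ∀ z ∈ D, poissonBracket f H z = 0

/-- `g` is on `U` the sum of a (finite or infinite) series of exponentials
`∑_{m ∈ ℤⁿ} aₘ exp ⟨cₘ, q⟩` with real constants `aₘ` and arbitrary real vectors `cₘ`; the series
is required to converge (unconditionally, i.e. absolutely) at every point of `U`. -/
def IsExpSeriesOn {n : ℕ} (g : (Fin n → ℝ) → ℝ) (U : Set (Fin n → ℝ)) : Prop :=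
  ∃ (a : (Fin n → ℤ) → ℝ) (c : (Fin n → ℤ) → Fin n → ℝ),
    ∀ q ∈ U, HasSum (fun m => a m * Real.exp (∑ i, c m i * q i)) (g q)

/-- The multi-indices `k ∈ ℤ₊ⁿ` with `|k| = k₁ + ⋯ + kₙ ≤ l`. -/
def multiIndices (n l : ℕ) : Finset (Fin n → ℕ) :=
  (Fintype.piFinset fun _ => Finset.range (l + 1)).filter fun k => ∑ i, k i ≤ l

/-- On `U × ℝⁿ`, `f` is a polynomial in the momenta, `f(q, p) = ∑_{|k| ≤ l} f_k(q) p^k`, whose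
coefficients `f_k` are series of exponentials in `q`. -/
def IsMomentumPolynomialOn {n : ℕ} (f : Phase n → ℝ) (U : Set (Fin n → ℝ)) : Prop :=
  ∃ (l : ℕ) (coeff : (Fin n → ℕ) → (Fin n → ℝ) → ℝ),
    (∀ k ∈ multiIndices n l, IsExpSeriesOn (coeff k) U) ∧
    ∀ q ∈ U, ∀ p : Fin n → ℝ,
      f (q, p) = ∑ k ∈ multiIndices n l, coeff k q * ∏ i, p i ^ k i

/-- Birkhoff integrability over an open set `U` of the configuration space: there are `n`
first integrals on `U × ℝⁿ`, polynomial in the momenta with series of exponentials in `q` as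
coefficients, that are independent, i.e. whose differentials are linearly independent at some
point. (These functions are real analytic, so if `U` is connected then independence at one point
is the same as independence on an open dense set.) -/
def BirkhoffIntegrableOn {n : ℕ} (H : Phase n → ℝ) (U : Set (Fin n → ℝ)) : Prop :=
  ∃ F : Fin n → Phase n → ℝ,
    (∀ j, IsMomentumPolynomialOn (F j) U ∧ IsFirstIntegralOn H (F j) (U ×ˢ Set.univ)) ∧
    ∃ z ∈ U ×ˢ (Set.univ : Set (Fin n → ℝ)), LinearIndependent ℝ fun j => fderiv ℝ (F j) z

/-- The Bianchi class A Hamiltonian with structure constants `ν = (n₁, n₂, n₃)`, in the variables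
`Q` (logarithms of the scale variables) and the conjugate momenta `p`. -/
noncomputable def bianchiHamiltonian (ν : Fin 3 → ℝ) (z : Phase 3) : ℝ :=
  2 * (∑ i, ∑ j ∈ Finset.Ioi i, z.2 i * z.2 j) - ∑ i, z.2 i ^ 2
    + 1 / 4 * (2 * (∑ i, ∑ j ∈ Finset.Ioi i, ν i * ν j * Real.exp (z.1 i + z.1 j))
      - ∑ i, ν i ^ 2 * Real.exp (2 * z.1 i))

end BirkhoffInt

/-! Group a first integral by exponents, `F = ∑_c P_c(p) exp⟨c, Q⟩`, where the polynomials `P_c`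
have bounded degree. Exponential series have unique coefficients, so `{F, H} = 0` becomes a
recurrence (`IsIntegralFamily`): a linear form `2 L_c(p)`, nonzero for `c ≠ 0`, times `P_c` equals a
combination of first derivatives of the `P_{c - eᵢ - eⱼ}`.

Comparing degrees, a nonzero `P_c` with `c ≠ 0` has a predecessor of strictly larger degree. The
degree bound forces every such chain to stop, and it can stop only at `c = 0`. So the support is
bounded, lies in the positive octant, and is empty if the seed `P_0` vanishes
(`IsIntegralFamily.support`).

On the ray `c = 2k eᵢ` the recurrence has a single source term. Since the ray ends after finitely
many steps, working back along it shows that `P_0` is invariant under the reflection `pᵢ ↦ 2 ∑_{j≠i}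
pⱼ - pᵢ` (`IsIntegralFamily.eval_reflection`). Products of two such reflections have infinite order,
and the only polynomials invariant under all three are `g(K)`, with `K` the kinetic energy
(`exists_eq_aeval_kinetic`).

Now `F - g(H)` has seed zero, so `F = g(H)`. All differentials of integrals are therefore multiples
of `dH`, and not even two can be independent. -/

namespace BirkhoffInt

/-! ### Uniqueness and termwise differentiation of exponential series -/

open Filter Topology Complex

/-- If `r < δ` and a real exponential series converges for `|t| < δ`, then it is dominated on
`|t| ≤ r` by a summable family. -/
lemma summable_abs_mul_exp_abs {ι : Type*} {w x : ι → ℝ} {δ r : ℝ} (hr : 0 ≤ r) (hrδ : r < δ)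
    (h : ∀ t, |t| < δ → Summable fun i => w i * Real.exp (x i * t)) :
    Summable fun i => |w i| * Real.exp (|x i| * r) := by
  have h₁ := (h r (by rwa [abs_of_nonneg hr])).abs
  have h₂ := (h (-r) (by rwa [abs_neg, abs_of_nonneg hr])).abs
  refine Summable.of_nonneg_of_le (fun i => by positivity) (fun i => ?_) (h₁.add h₂)
  rw [abs_mul, abs_mul, Real.abs_exp, Real.abs_exp, ← mul_add]
  refine mul_le_mul_of_nonneg_left ?_ (abs_nonneg _)
  rcases abs_cases (x i) with ⟨h, -⟩ | ⟨h, -⟩ <;> rw [h]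
  · exact le_add_of_nonneg_right (Real.exp_pos _).le
  · rw [neg_mul, ← mul_neg]
    exact le_add_of_nonneg_left (Real.exp_pos _).le

/-- Termwise differentiation of an exponential series. -/
lemma hasSum_mul_of_hasDerivAt {ι : Type*} {w x : ι → ℝ} {f : ℝ → ℝ} {f' δ : ℝ} (hδ : 0 < δ)
    (h : ∀ t, |t| < δ → HasSum (fun i => w i * Real.exp (x i * t)) (f t))
    (hf : HasDerivAt f f' 0) : HasSum (fun i => w i * x i) f' := by
  have hδ2 : 0 < δ / 2 := by positivity
  have hs := summable_abs_mul_exp_abs hδ2.le (half_lt_self hδ) fun t ht => (h t ht).summable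
  -- The bound `|x| ≤ (4/δ) exp(|x| δ/4)` absorbs the factor produced by differentiation. It uses up
  -- the half of the margin `δ/2` that `|t| < δ/4` leaves free.
  set u : ι → ℝ := fun i => (4 / δ) * (|w i| * Real.exp (|x i| * (δ / 2)))
  have hu : Summable u := hs.mul_left _
  have bound : ∀ i, ∀ t ∈ Metric.ball (0 : ℝ) (δ / 4),
      ‖w i * (Real.exp (x i * t) * x i)‖ ≤ u i := by
    intro i t ht
    rw [mem_ball_zero_iff, Real.norm_eq_abs] at ht
    have h1 : Real.exp (x i * t) ≤ Real.exp (|x i| * (δ / 4)) := by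
      refine Real.exp_le_exp.2 ((le_abs_self _).trans ?_)
      rw [abs_mul]
      gcongr
    have h2 : |x i| ≤ 4 / δ * Real.exp (|x i| * (δ / 4)) := by
      have := Real.add_one_le_exp (|x i| * (δ / 4))
      rw [div_mul_eq_mul_div, le_div_iff₀ hδ]
      linarith
    calc ‖w i * (Real.exp (x i * t) * x i)‖ = |w i| * (Real.exp (x i * t) * |x i|) := by
          rw [Real.norm_eq_abs, abs_mul, abs_mul, Real.abs_exp]
      _ ≤ |w i| * (Real.exp (|x i| * (δ / 4)) * (4 / δ * Real.exp (|x i| * (δ / 4)))) := by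
          gcongr
      _ = u i := by
          have : |x i| * (δ / 2) = |x i| * (δ / 4) + |x i| * (δ / 4) := by ring
          simp only [u]
          rw [this, Real.exp_add]
          ring
  have h0 : (0 : ℝ) ∈ Metric.ball (0 : ℝ) (δ / 4) := Metric.mem_ball_self (by positivity)
  have key := hasDerivAt_tsum_of_isPreconnected (g := fun i t => w i * Real.exp (x i * t)) hu
    Metric.isOpen_ball (convex_ball (0 : ℝ) (δ / 4)).isPreconnected
    (fun i t _ => by
      simpa using (((hasDerivAt_id t).const_mul (x i)).exp).const_mul (w i)) bound h0
    (h 0 (by simpa using hδ)).summable h0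
  have hfe : f =ᶠ[𝓝 0] fun t => ∑' i, w i * Real.exp (x i * t) := by
    filter_upwards [Metric.ball_mem_nhds (0 : ℝ) hδ] with t ht
    rw [mem_ball_zero_iff, Real.norm_eq_abs] at ht
    exact (h t ht).tsum_eq.symm
  have hd := hf.unique (key.congr_of_eventuallyEq hfe)
  have hsum : Summable fun i => w i * (Real.exp (x i * 0) * x i) :=
    Summable.of_norm_bounded hu fun i => bound i 0 h0
  have := hsum.hasSum
  rw [← hd] at this
  simpa using this

/-- An exponential series vanishing on an interval around `0` vanishes on the imaginary axis. -/
lemma hasSum_cexp_I_of_hasSum_exp_zero {ι : Type*} {w x : ι → ℝ} {δ : ℝ} (hδ : 0 < δ)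
    (h : ∀ t, |t| < δ → HasSum (fun i => w i * Real.exp (x i * t)) 0) (s : ℝ) :
    HasSum (fun i => (w i : ℂ) * cexp (x i * s * I)) 0 := by
  have hδ2 : 0 < δ / 2 := by positivity
  have hs := summable_abs_mul_exp_abs hδ2.le (half_lt_self hδ) fun t ht => (h t ht).summable
  set S : Set ℂ := re ⁻¹' Metric.ball 0 (δ / 2)
  have hSo : IsOpen S := Metric.isOpen_ball.preimage continuous_re
  have hSc : IsPreconnected S :=
    ((convex_ball (0 : ℝ) (δ / 2)).linear_preimage reLm).isPreconnected
  have bound : ∀ i, ∀ z ∈ S, ‖(w i : ℂ) * cexp (x i * z)‖ ≤ |w i| * Real.exp (|x i| * (δ / 2)) := by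
    intro i z hz
    have hz' : |z.re| < δ / 2 := by simpa [S] using hz
    rw [norm_mul, norm_real, Real.norm_eq_abs, Complex.norm_exp, re_ofReal_mul]
    refine mul_le_mul_of_nonneg_left (Real.exp_le_exp.2 ((le_abs_self _).trans ?_)) (abs_nonneg _)
    rw [abs_mul]
    gcongr
  have hd : DifferentiableOn ℂ (fun z => ∑' i, (w i : ℂ) * cexp (x i * z)) S :=
    differentiableOn_tsum_of_summable_norm hs (fun i => by fun_prop) hSo bound
  have h0 : (0 : ℂ) ∈ S := by simp [S, hδ]
  -- Identity theorem on the strip: the zeros on the real segment accumulate at `0`.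
  have hz := (hd.analyticOnNhd hSo).eqOn_zero_of_preconnected_of_frequently_eq_zero hSc h0 (by
    have hev : ∀ᶠ t : ℝ in 𝓝[≠] 0, (∑' i, (w i : ℂ) * cexp (x i * (t : ℂ))) = 0 := by
      filter_upwards [mem_nhdsWithin_of_mem_nhds (Metric.ball_mem_nhds (0 : ℝ) hδ)] with t ht
      rw [mem_ball_zero_iff, Real.norm_eq_abs] at ht
      have := Complex.hasSum_ofReal.2 (h t ht)
      simpa using this.tsum_eq
    have hmap : Tendsto (fun t : ℝ => (t : ℂ)) (𝓝[≠] 0) (𝓝[≠] 0) := by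
      refine tendsto_nhdsWithin_iff.2 ⟨?_, ?_⟩
      · exact tendsto_nhdsWithin_of_tendsto_nhds (by
          simpa using continuous_ofReal.tendsto (0 : ℝ))
      · filter_upwards [self_mem_nhdsWithin] with t ht
        simpa using ht
    exact hmap.frequently hev.frequently)
  have hsI : (s * I : ℂ) ∈ S := by simp [S, hδ]
  have hsum : Summable fun i => (w i : ℂ) * cexp (x i * (s * I)) :=
    Summable.of_norm_bounded hs fun i => bound i _ hsI
  have := hsum.hasSum
  rw [show ∑' i, (w i : ℂ) * cexp (x i * (s * I)) = 0 from hz hsI] at this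
  simpa [mul_assoc] using this

/-- The primitive `∫₀ˢ exp (i y σ) dσ`. -/
noncomputable def expPrimitive (y s : ℝ) : ℂ :=
  if y = 0 then (s : ℂ) else (cexp (y * s * I) - 1) / (y * I)

lemma hasDerivAt_expPrimitive (y s : ℝ) :
    HasDerivAt (expPrimitive y) (cexp (y * s * I)) s := by
  unfold expPrimitive
  split_ifs with hy
  · subst hy
    simpa using (hasDerivAt_id s).ofReal_comp
  · have hy' : (y * I : ℂ) ≠ 0 := by simp [hy]
    have h1 : HasDerivAt (fun s : ℝ => (y * s * I : ℂ)) (y * I) s := by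
      simpa using (((hasDerivAt_id s).ofReal_comp).const_mul (y : ℂ)).mul_const I
    have := (h1.cexp.sub_const 1).div_const (y * I : ℂ)
    rwa [mul_div_cancel_right₀ _ hy'] at this

lemma norm_expPrimitive_le (y s : ℝ) : ‖expPrimitive y s‖ ≤ |s| := by
  unfold expPrimitive
  split_ifs with hy
  · simp
  · rw [norm_div, norm_mul, norm_I, mul_one, norm_real, Real.norm_eq_abs,
      div_le_iff₀ (abs_pos.2 hy)]
    have := Real.norm_exp_I_mul_ofReal_sub_one_le (x := y * s)
    rw [Real.norm_eq_abs, abs_mul, mul_comm |y|] at this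
    simpa [mul_comm, mul_left_comm] using this

lemma tendsto_expPrimitive_div {y : ℝ} (hy : y ≠ 0) :
    Tendsto (fun s : ℝ => expPrimitive y s / s) atTop (𝓝 0) := by
  have h : Tendsto (fun s : ℝ => 2 / |y| / s) atTop (𝓝 0) :=
    tendsto_const_nhds.div_atTop tendsto_id
  refine squeeze_zero_norm' ?_ h
  filter_upwards [eventually_gt_atTop 0] with s hs
  rw [expPrimitive, if_neg hy, norm_div, norm_div, norm_mul, norm_I, mul_one, norm_real, norm_real,
    Real.norm_eq_abs, Real.norm_eq_abs, abs_of_pos hs]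
  gcongr
  refine (norm_sub_le _ _).trans ?_
  have := Complex.norm_exp_ofReal_mul_I (y * s)
  push_cast at this
  rw [this, norm_one]
  norm_num

/-- Uniqueness for one-dimensional exponential series: a coefficient whose exponent is isolated
from the others in the sense that no other term shares it is zero if the series sums to zero. -/
lemma coeff_eq_zero_of_hasSum_exp_zero {ι : Type*} {w x : ι → ℝ} {δ : ℝ} (hδ : 0 < δ)
    (h : ∀ t, |t| < δ → HasSum (fun i => w i * Real.exp (x i * t)) 0) (i₀ : ι)
    (hx : ∀ i, w i ≠ 0 → i ≠ i₀ → x i ≠ x i₀) : w i₀ = 0 := by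
  -- Shifting all exponents by `x i₀` makes `i₀` the zero-frequency term. The coefficient is then
  -- the mean value of the series along the imaginary axis, computed from termwise primitives.
  set y : ι → ℝ := fun i => x i - x i₀
  have hy : ∀ t, |t| < δ → HasSum (fun i => w i * Real.exp (y i * t)) 0 := by
    intro t ht
    have := (h t ht).mul_right (Real.exp (-(x i₀ * t)))
    rw [zero_mul] at this
    refine this.congr_fun fun i => ?_
    rw [mul_assoc, ← Real.exp_add]
    congr 2
    simp only [y]
    ring
  have hI := hasSum_cexp_I_of_hasSum_exp_zero hδ hy
  have hw : Summable fun i => |w i| := by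
    have := (h 0 (by simpa using hδ)).summable.abs
    simpa using this
  have hsum0 : Summable fun i => (w i : ℂ) * expPrimitive (y i) 0 := by
    refine Summable.of_norm_bounded hw fun i => ?_
    have := norm_expPrimitive_le (y i) 0
    rw [abs_zero, norm_le_zero_iff] at this
    simp [this]
  have hD : ∀ s : ℝ, HasDerivAt (fun s => ∑' i, (w i : ℂ) * expPrimitive (y i) s) 0 s := by
    intro s
    have := hasDerivAt_tsum (g := fun i (s : ℝ) => (w i : ℂ) * expPrimitive (y i) s)
      (g' := fun i (s : ℝ) => (w i : ℂ) * cexp (y i * s * I)) (y₀ := (0 : ℝ)) hw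
      (fun i s => (hasDerivAt_expPrimitive (y i) s).const_mul _) (fun i s => by
        have := Complex.norm_exp_ofReal_mul_I (y i * s)
        push_cast at this
        rw [norm_mul, this, mul_one, norm_real, Real.norm_eq_abs]) hsum0 s
    rwa [(hI s).tsum_eq] at this
  have hconst : ∀ s : ℝ, ∑' i, (w i : ℂ) * expPrimitive (y i) s = 0 := by
    intro s
    have h0 : ∑' i, (w i : ℂ) * expPrimitive (y i) 0 = 0 := by
      have : ∀ i, expPrimitive (y i) 0 = 0 := fun i => by
        simpa using norm_expPrimitive_le (y i) 0
      simp [this]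
    rw [← h0]
    exact is_const_of_deriv_eq_zero (fun s => (hD s).differentiableAt) (fun s => (hD s).deriv) s 0
  classical
  -- Mean over `[0, s]` as `s → ∞`: terms of nonzero frequency average out, and `|w i|` dominates.
  have hlim : Tendsto (fun s : ℝ => ∑' i, (w i : ℂ) * (expPrimitive (y i) s / s)) atTop
      (𝓝 (∑' i, if i = i₀ then (w i : ℂ) else 0)) := by
    refine tendsto_tsum_of_dominated_convergence hw (fun i => ?_) ?_
    · split_ifs with hi
      · subst hi
        refine tendsto_const_nhds.congr' ?_
        filter_upwards [eventually_gt_atTop (0 : ℝ)] with s hs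
        have : (s : ℂ) ≠ 0 := by exact_mod_cast hs.ne'
        simp [expPrimitive, y, this]
      · by_cases hwi : w i = 0
        · simp [hwi]
        · simpa using (tendsto_expPrimitive_div (sub_ne_zero.2 (hx i hwi hi))).const_mul (w i : ℂ)
    · filter_upwards [eventually_gt_atTop (0 : ℝ)] with s hs i
      rw [norm_mul, norm_div, norm_real, norm_real, Real.norm_eq_abs, Real.norm_eq_abs]
      refine mul_le_of_le_one_right (abs_nonneg _) ?_
      exact div_le_one_of_le₀ (norm_expPrimitive_le _ _) (abs_nonneg _)
  rw [tsum_ite_eq] at hlim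
  have hzero : ∀ s : ℝ, ∑' i, (w i : ℂ) * (expPrimitive (y i) s / s) = 0 := by
    intro s
    simp_rw [← mul_div_assoc]
    rw [tsum_div_const, hconst, zero_div]
  simp_rw [hzero] at hlim
  have := tendsto_nhds_unique hlim tendsto_const_nhds
  exact_mod_cast this

/-- A countable set of nonzero vectors can be avoided by the orthogonal complement of a vector. -/
lemma exists_dotProduct_ne_zero {n : ℕ} {C : Set (Fin n → ℝ)} (hC : C.Countable)
    (h0 : ∀ c ∈ C, c ≠ 0) : ∃ v : Fin n → ℝ, ∀ c ∈ C, c ⬝ᵥ v ≠ 0 := by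
  classical
  -- `v` is sought on the moment curve `(1, t, t², …)`. Each `c` excludes only the finitely many
  -- roots of `P c`, so countably many `t` are excluded in all.
  let P : (Fin n → ℝ) → Polynomial ℝ := fun c => ∑ i : Fin n, Polynomial.monomial (i : ℕ) (c i)
  have hP : ∀ c ∈ C, P c ≠ 0 := by
    intro c hc hPc
    refine h0 c hc (funext fun j => ?_)
    have := congrArg (Polynomial.coeff · (j : ℕ)) hPc
    simpa [P, Polynomial.finsetSum_coeff, Polynomial.coeff_monomial, Fin.val_inj] using this
  have hcount : (⋃ c ∈ C, {t : ℝ | (P c).IsRoot t}).Countable :=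
    hC.biUnion fun c hc => (Polynomial.finite_setOfPred_isRoot (hP c hc)).countable
  obtain ⟨t, ht⟩ : ∃ t : ℝ, t ∉ ⋃ c ∈ C, {t : ℝ | (P c).IsRoot t} := by
    by_contra! hall
    exact Set.not_countable_univ (α := ℝ) (hcount.mono fun t _ => hall t)
  refine ⟨fun i => t ^ (i : ℕ), fun c hc hct => ht ?_⟩
  simp only [Set.mem_iUnion, Set.mem_ofPred_eq]
  refine ⟨c, hc, ?_⟩
  simpa [P, Polynomial.IsRoot, Polynomial.eval_finsetSum, dotProduct] using hct

lemma exists_pos_forall_add_smul_mem {n : ℕ} {U : Set (Fin n → ℝ)} (hU : IsOpen U)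
    {q : Fin n → ℝ} (hq : q ∈ U) (v : Fin n → ℝ) :
    ∃ δ > 0, ∀ t : ℝ, |t| < δ → q + t • v ∈ U := by
  have hc : Tendsto (fun t : ℝ => q + t • v) (𝓝 0) (𝓝 (q + (0 : ℝ) • v)) :=
    (by fun_prop : Continuous fun t : ℝ => q + t • v).tendsto 0
  rw [zero_smul, add_zero] at hc
  obtain ⟨δ, hδ, h⟩ := Metric.mem_nhds_iff.1 (hc (hU.mem_nhds hq))
  exact ⟨δ, hδ, fun t ht => h (by simpa using ht)⟩

/-- Uniqueness of absolutely convergent exponential series with arbitrary exponents. -/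
theorem exp_series_coeff_eq_zero {n : ℕ} {U : Set (Fin n → ℝ)} (hU : IsOpen U) (hne : U.Nonempty)
    {a : (Fin n → ℝ) → ℝ} (h : ∀ q ∈ U, HasSum (fun c => a c * Real.exp (c ⬝ᵥ q)) 0)
    (c₀ : Fin n → ℝ) : a c₀ = 0 := by
  obtain ⟨q, hq⟩ := hne
  have hcount : {c | a c ≠ 0}.Countable := by
    refine (h q hq).summable.countable_support.mono fun c hc => ?_
    exact mul_ne_zero hc (Real.exp_pos _).ne'
  -- A direction separating `c₀` from every other exponent that occurs reduces the claim to one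
  -- variable.
  obtain ⟨v, hv⟩ := exists_dotProduct_ne_zero
    (C := (fun c => c - c₀) '' ({c | a c ≠ 0} \ {c₀})) ((hcount.mono Set.sdiff_subset).image _) (by
      rintro _ ⟨c, ⟨-, hc⟩, rfl⟩
      exact sub_ne_zero.2 hc)
  obtain ⟨δ, hδ, hδU⟩ := exists_pos_forall_add_smul_mem hU hq v
  have := coeff_eq_zero_of_hasSum_exp_zero (w := fun c => a c * Real.exp (c ⬝ᵥ q))
    (x := fun c => c ⬝ᵥ v) hδ (fun t ht => by
      refine (h _ (hδU t ht)).congr_fun fun c => ?_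
      rw [mul_assoc, ← Real.exp_add, dotProduct_add, dotProduct_smul, smul_eq_mul, mul_comm t]) c₀
    (fun c hc hne heq => hv (c - c₀) ⟨c, ⟨left_ne_zero_of_mul hc, hne⟩, rfl⟩ (by
      rw [sub_dotProduct, heq, sub_self]))
  exact (mul_eq_zero.1 this).resolve_right (Real.exp_pos _).ne'

/-- Termwise directional derivative of an exponential series. -/
lemma hasSum_dotProduct_mul_of_hasDerivAt {n : ℕ} {U : Set (Fin n → ℝ)} (hU : IsOpen U)
    {a : (Fin n → ℝ) → ℝ} {g : (Fin n → ℝ) → ℝ}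
    (h : ∀ q ∈ U, HasSum (fun c => a c * Real.exp (c ⬝ᵥ q)) (g q)) {q : Fin n → ℝ} (hq : q ∈ U)
    (v : Fin n → ℝ) {g' : ℝ} (hg : HasDerivAt (fun t : ℝ => g (q + t • v)) g' 0) :
    HasSum (fun c => (c ⬝ᵥ v) * a c * Real.exp (c ⬝ᵥ q)) g' := by
  obtain ⟨δ, hδ, hδU⟩ := exists_pos_forall_add_smul_mem hU hq v
  have := hasSum_mul_of_hasDerivAt (w := fun c => a c * Real.exp (c ⬝ᵥ q))
    (x := fun c => c ⬝ᵥ v) hδ (fun t ht => by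
      refine (h _ (hδU t ht)).congr_fun fun c => ?_
      rw [mul_assoc, ← Real.exp_add, dotProduct_add, dotProduct_smul, smul_eq_mul, mul_comm t]) hg
  exact this.congr_fun fun c => by ring

/-- An exponential series can be indexed by its exponents. -/
lemma IsExpSeriesOn.exists_hasSum {n : ℕ} {g : (Fin n → ℝ) → ℝ} {U : Set (Fin n → ℝ)}
    (h : IsExpSeriesOn g U) :
    ∃ A : (Fin n → ℝ) → ℝ, ∀ q ∈ U, HasSum (fun c => A c * Real.exp (c ⬝ᵥ q)) (g q) := by
  obtain ⟨a, c, h⟩ := h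
  refine ⟨fun e => ∑' m : c ⁻¹' {e}, a m, fun q hq => ?_⟩
  refine ((h q hq).tsum_fiberwise c).congr_fun fun e => ?_
  rw [← tsum_mul_right]
  refine tsum_congr fun m => ?_
  have hm : c m = e := m.2
  simp [← dotProduct.eq_def, hm]

end BirkhoffInt

/-! ### The recurrence for the coefficients and its consequences -/

namespace BirkhoffInt

open MvPolynomial

/-- The inner product of `c` with `p` in the Lorentzian metric `2 ∑_{i<j} cᵢpⱼ - ∑ cᵢpᵢ`, as a
linear form in `p`. -/
noncomputable def lorentzForm (c : Fin 3 → ℝ) : MvPolynomial (Fin 3) ℝ :=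
  ∑ i, C (c i) * (∑ j, X j - 2 * X i)

/-- The coefficient of `exp (Qᵢ + Qⱼ)` in the potential, as a sum over ordered pairs. -/
noncomputable def potentialCoeff (ν : Fin 3 → ℝ) (i j : Fin 3) : ℝ :=
  if i = j then -(ν i * ν j) / 4 else ν i * ν j / 4

/-- The exponent of `exp (Qᵢ + Qⱼ)`. -/
noncomputable def pairExponent (i j : Fin 3) : Fin 3 → ℝ := Pi.single i 1 + Pi.single j 1

/-- The equations satisfied by the coefficients of a first integral `∑ P_c(p) exp ⟨c, Q⟩`. -/
def IsIntegralFamily (ν : Fin 3 → ℝ) (P : (Fin 3 → ℝ) → MvPolynomial (Fin 3) ℝ) : Prop :=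
  ∀ c, 2 * lorentzForm c * P c =
    ∑ i, ∑ j, C (potentialCoeff ν i j) *
      (pderiv i (P (c - pairExponent i j)) + pderiv j (P (c - pairExponent i j)))

lemma eval_lorentzForm (c p : Fin 3 → ℝ) :
    eval p (lorentzForm c) = ∑ i, c i * (∑ j, p j - 2 * p i) := by
  simp [lorentzForm]

/-- The Lorentzian metric is nondegenerate: pairing `c` with the basis vectors recovers `c`. -/
lemma lorentzForm_ne_zero {c : Fin 3 → ℝ} (hc : c ≠ 0) : lorentzForm c ≠ 0 := by
  intro h
  have h0 := congrArg (eval (Pi.single 0 1)) h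
  have h1 := congrArg (eval (Pi.single 1 1)) h
  have h2 := congrArg (eval (Pi.single 2 1)) h
  simp [eval_lorentzForm, Fin.sum_univ_three] at h0 h1 h2
  refine hc (funext fun i => ?_)
  fin_cases i <;> simp <;> linarith

lemma totalDegree_lorentzForm_pos {c : Fin 3 → ℝ} (hc : c ≠ 0) :
    0 < (2 * lorentzForm c).totalDegree := by
  have h2 : (2 * lorentzForm c) ≠ 0 := mul_ne_zero two_ne_zero (lorentzForm_ne_zero hc)
  by_contra! h
  have hC := totalDegree_eq_zero_iff_eq_C.1 (Nat.le_zero.1 h)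
  have h0 : coeff 0 (2 * lorentzForm c) = 0 := by
    rw [← constantCoeff_eq]
    simp [lorentzForm]
  rw [h0, C_0] at hC
  exact h2 hC

lemma totalDegree_pderiv_le {σ R : Type*} [CommSemiring R] (i : σ) (f : MvPolynomial σ R) :
    (pderiv i f).totalDegree ≤ f.totalDegree := by
  classical
  conv_lhs => rw [f.as_sum, map_sum]
  refine totalDegree_finsetSum_le fun s hs => ?_
  rw [pderiv_monomial]
  refine (totalDegree_monomial_le _ _).trans ((?_ : _ ≤ _).trans (le_totalDegree hs))
  exact Finsupp.degree_mono tsub_le_self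

variable {ν : Fin 3 → ℝ} {P : (Fin 3 → ℝ) → MvPolynomial (Fin 3) ℝ}

/-- The linear factor on the left raises the degree by at least one, while derivatives on the right
do not raise it. -/
lemma IsIntegralFamily.exists_totalDegree_lt (hP : IsIntegralFamily ν P) {c : Fin 3 → ℝ}
    (hc : c ≠ 0) (hPc : P c ≠ 0) :
    ∃ i j, (P c).totalDegree < (P (c - pairExponent i j)).totalDegree := by
  by_contra! h
  have hdeg : (2 * lorentzForm c * P c).totalDegree ≤ (P c).totalDegree := by
    rw [hP c]
    refine totalDegree_finsetSum_le fun i _ => totalDegree_finsetSum_le fun j _ => ?_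
    refine (totalDegree_mul _ _).trans ?_
    rw [totalDegree_C, zero_add]
    refine (totalDegree_add _ _).trans (max_le ?_ ?_)
    · exact (totalDegree_pderiv_le _ _).trans (h i j)
    · exact (totalDegree_pderiv_le _ _).trans (h i j)
  rw [totalDegree_mul_of_isDomain (mul_ne_zero two_ne_zero (lorentzForm_ne_zero hc)) hPc] at hdeg
  have := totalDegree_lorentzForm_pos hc
  omega

/-- The support of an integral of bounded degree is bounded and contained in the positive
octant, and it contains the origin. -/
lemma IsIntegralFamily.support (hP : IsIntegralFamily ν P) {l : ℕ}
    (hl : ∀ c, (P c).totalDegree ≤ l) {c : Fin 3 → ℝ} (hPc : P c ≠ 0) :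
    P 0 ≠ 0 ∧ 0 ≤ c ∧ ∑ i, c i + 2 * (P c).totalDegree ≤ 2 * l := by
  -- Predecessors have larger degree, hence a smaller gap to `l`. Passing to one lowers `∑ cᵢ` by
  -- `2` and raises the degree by at least `1`, so a bound on `∑ cᵢ + 2 deg` carries over.
  induction h : l - (P c).totalDegree using Nat.strong_induction_on generalizing c with
  | _ N ih =>
    by_cases hc : c = 0
    · subst hc
      refine ⟨hPc, le_rfl, ?_⟩
      have : ((P 0).totalDegree : ℝ) ≤ l := by exact_mod_cast hl 0
      simpa using this
    · obtain ⟨i, j, hij⟩ := hP.exists_totalDegree_lt hc hPc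
      have hl' := hl (c - pairExponent i j)
      obtain ⟨h0, hpos, hsum⟩ := ih _ (by omega) (c := c - pairExponent i j)
        (fun h0 => by simp [h0] at hij) rfl
      have hb : 0 ≤ pairExponent i j :=
        add_nonneg (Pi.single_nonneg.2 zero_le_one) (Pi.single_nonneg.2 zero_le_one)
      refine ⟨h0, hb.trans (sub_nonneg.1 hpos), ?_⟩
      have hs : ∑ k, (c - pairExponent i j) k = ∑ k, c k - 2 := by
        simp [pairExponent, Finset.sum_add_distrib]
        norm_num
      have : ((P c).totalDegree : ℝ) + 1 ≤ (P (c - pairExponent i j)).totalDegree := by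
        exact_mod_cast hij
      rw [hs] at hsum
      linarith

lemma hasDerivAt_eval_update {σ : Type*} [Fintype σ] [DecidableEq σ] (f : MvPolynomial σ ℝ)
    (p : σ → ℝ) (i : σ) (t : ℝ) :
    HasDerivAt (fun t => eval (Function.update p i t) f)
      (eval (Function.update p i t) (pderiv i f)) t := by
  induction f using MvPolynomial.induction_on with
  | C a => simpa using hasDerivAt_const t a
  | add f g hf hg => simpa using hf.fun_add hg
  | mul_X f j hf =>
    by_cases hij : j = i
    · subst hij
      simpa [pderiv_X, mul_comm, add_comm] using hf.fun_mul (hasDerivAt_id' t)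
    · simpa [pderiv_X, hij, Pi.single_apply, mul_comm, Ne.symm hij] using hf.mul_const (p j)

/-- The equation along the ray spanned by `2eᵢ`. -/
lemma IsIntegralFamily.ray (hP : IsIntegralFamily ν P) (hpos : ∀ c, P c ≠ 0 → 0 ≤ c) (i : Fin 3)
    (k : ℕ) :
    C (4 * (k + 1 : ℝ)) * (∑ j, X j - 2 * X i) * P (Pi.single i (2 * (k + 1 : ℝ))) =
      C (-(ν i ^ 2) / 2) * pderiv i (P (Pi.single i (2 * (k : ℝ)))) := by
  have hk := hP (Pi.single i (2 * (k + 1 : ℝ)))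
  have hform : lorentzForm (Pi.single i (2 * (k + 1 : ℝ))) =
      C (2 * (k + 1 : ℝ)) * (∑ j, X j - 2 * X i) := by
    unfold lorentzForm
    rw [Finset.sum_eq_single i] <;> simp +contextual
  -- Subtracting any pair other than `(i, i)` leaves a negative coordinate, outside the support.
  have hvanish : ∀ a b, ¬ (a = i ∧ b = i) →
      P (Pi.single i (2 * (k + 1 : ℝ)) - pairExponent a b) = 0 := by
    intro a b hab
    by_contra hne
    have h0 := hpos _ hne
    rcases not_and_or.1 hab with h | h
    · have h1 := h0 a
      have h2 : (0 : ℝ) ≤ (Pi.single b 1 : Fin 3 → ℝ) a :=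
        (Pi.single_nonneg.2 zero_le_one : (0 : Fin 3 → ℝ) ≤ Pi.single b 1) a
      simp [pairExponent, Pi.single_eq_of_ne h] at h1
      linarith
    · have h1 := h0 b
      have h2 : (0 : ℝ) ≤ (Pi.single a 1 : Fin 3 → ℝ) b :=
        (Pi.single_nonneg.2 zero_le_one : (0 : Fin 3 → ℝ) ≤ Pi.single a 1) b
      simp [pairExponent, Pi.single_eq_of_ne h] at h1
      linarith
  have hsub : (Pi.single i (2 * (k + 1 : ℝ)) : Fin 3 → ℝ) - pairExponent i i =
      Pi.single i (2 * (k : ℝ)) := by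
    rw [pairExponent, ← Pi.single_add, ← Pi.single_sub]
    congr 1
    ring
  rw [Finset.sum_eq_single i, Finset.sum_eq_single i, hsub, hform] at hk
  · have h2 : (2 : MvPolynomial (Fin 3) ℝ) = C 2 := rfl
    calc _ = 2 * (C (2 * (k + 1 : ℝ)) * (∑ j, X j - 2 * X i)) *
          P (Pi.single i (2 * (k + 1 : ℝ))) := by
          rw [show (4 * (k + 1 : ℝ)) = 2 * (2 * (k + 1)) by ring, C_mul (a := 2), ← h2]
          ring
      _ = _ := by
          rw [hk, potentialCoeff, if_pos rfl, ← two_mul, ← mul_assoc, h2, ← C_mul]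
          congr 2
          ring
  · intro b _ hb
    simp [hvanish i b (fun h => hb h.2)]
  · simp
  · intro a _ ha
    refine Finset.sum_eq_zero fun b _ => ?_
    simp [hvanish a b (fun h => ha h.1)]
  · simp

lemma sum_update_eq (p : Fin 3 → ℝ) (i : Fin 3) (t : ℝ) :
    ∑ j, Function.update p i t j = ∑ j, p j - p i + t := by
  rw [Finset.sum_update_of_mem (Finset.mem_univ i), ← Finset.sum_erase_eq_sub (Finset.mem_univ i),
    Finset.sdiff_singleton_eq_erase, add_comm]

/-- The seed of an integral is invariant under the reflection in `eᵢ`. -/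
lemma IsIntegralFamily.eval_reflection (hν : ∀ i, ν i ≠ 0) (hP : IsIntegralFamily ν P) {l : ℕ}
    (hl : ∀ c, (P c).totalDegree ≤ l) (i : Fin 3) (p : Fin 3 → ℝ) :
    eval (Function.update p i (2 * ∑ j, p j - 3 * p i)) (P 0) = eval p (P 0) := by
  -- `pᵢ = S` is the mirror of the reflection.
  set S : ℝ := ∑ j, p j - p i with hS
  have hray := hP.ray (fun c hc => (hP.support hl hc).2.1) i
  -- Downward induction along the ray, with symmetry about `S` as the claim. It is trivial for `k >
  -- l`, where the coefficient vanishes. If the coefficient at `k + 1` is even about `S`, the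
  -- recurrence makes the derivative at `k` equal to `S - t` times an even function, so the
  -- coefficient at `k` is even.
  have key : ∀ m k : ℕ, l < k + m → ∀ u : ℝ,
      eval (Function.update p i (S + u)) (P (Pi.single i (2 * (k : ℝ)))) =
        eval (Function.update p i (S - u)) (P (Pi.single i (2 * (k : ℝ)))) := by
    intro m
    induction m with
    | zero =>
      intro k hk u
      have : P (Pi.single i (2 * (k : ℝ))) = 0 := by
        by_contra hne
        have h1 := (hP.support hl hne).2.2
        have h2 : (l : ℝ) < k := by exact_mod_cast hk
        have h3 : (0 : ℝ) ≤ (P (Pi.single i (2 * (k : ℝ)))).totalDegree := Nat.cast_nonneg _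
        rw [Finset.sum_pi_single'] at h1
        simp only [Finset.mem_univ, if_true] at h1
        linarith
      simp [this]
    | succ m ih =>
      intro k hk u
      set f := P (Pi.single i (2 * (k : ℝ)))
      have hder : ∀ t, eval (Function.update p i t) (pderiv i f) =
          (-8 * (k + 1) / ν i ^ 2) * (S - t) *
            eval (Function.update p i t) (P (Pi.single i (2 * (k + 1 : ℝ)))) := by
        intro t
        have h1 := congrArg (eval (Function.update p i t)) (hray k)
        simp only [map_mul, map_sub, map_sum, eval_C, eval_X, sum_update_eq, map_ofNat,
          Function.update_self] at h1
        have hνi := hν i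
        rw [← hS, show S + t - 2 * t = S - t by ring] at h1
        generalize eval (Function.update p i t) (P (Pi.single i (2 * (k + 1 : ℝ)))) = A at h1 ⊢
        field_simp
        linear_combination 2 * h1
      have hd : ∀ u : ℝ, HasDerivAt (fun u => eval (Function.update p i (S + u)) f -
          eval (Function.update p i (S - u)) f) 0 u := by
        intro u
        have h1 := (hasDerivAt_eval_update f p i (S + u)).comp u
          ((hasDerivAt_id u).const_add S)
        have h2 := (hasDerivAt_eval_update f p i (S - u)).comp u
          ((hasDerivAt_id u).const_sub S)
        have h3 := h1.sub h2
        refine h3.congr_deriv ?_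
        have h4 := ih (k + 1) (by omega) u
        push_cast at h4
        rw [hder, hder, h4]
        ring
      have hc := is_const_of_deriv_eq_zero (fun u => (hd u).differentiableAt)
        (fun u => (hd u).deriv) u 0
      simp only [add_zero, sub_zero, sub_self] at hc
      exact sub_eq_zero.1 hc
  -- With this `u`, `S - u = pᵢ` and `S + u` is its mirror image.
  have := key (l + 1) 0 (by omega) (S - p i)
  rw [sub_sub_cancel, Function.update_eq_self] at this
  simp only [Nat.cast_zero, mul_zero, Pi.single_zero] at this
  rw [← this]
  congr 2
  rw [hS]
  ring_nf

end BirkhoffInt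

/-! ### Polynomials invariant under the three reflections -/

namespace BirkhoffInt

open MvPolynomial

/-- The kinetic energy `2 ∑_{i<j} pᵢpⱼ - ∑ pᵢ²`. -/
noncomputable def kinetic : MvPolynomial (Fin 3) ℝ := ∑ i, X i * (∑ j, X j - 2 * X i)

lemma eval_kinetic (p : Fin 3 → ℝ) : eval p kinetic = ∑ i, p i * (∑ j, p j - 2 * p i) := by
  simp [kinetic]

lemma polynomial_eq_of_periodic (r : Polynomial ℝ) {a : ℝ} (ha : a ≠ 0)
    (h : ∀ t, r.eval (t + a) = r.eval t) (s t : ℝ) : r.eval s = r.eval t := by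
  have hper : ∀ n : ℕ, r.eval (s + n * a) = r.eval s := by
    intro n
    induction n with
    | zero => simp
    | succ n ih => rw [← ih, ← h (s + n * a)]; push_cast; ring_nf
  have hinj : Function.Injective fun n : ℕ => s + n * a := fun m n hmn => by
    simpa [ha] using hmn
  have : r = Polynomial.C (r.eval s) := by
    refine Polynomial.eq_of_infinite_eval_eq _ _ ((Set.infinite_range_of_injective hinj).mono ?_)
    rintro _ ⟨n, rfl⟩
    simp [hper n]
  rw [this]
  simp

/-- A polynomial function invariant under the reflections in the first two variables depends, for
`z ≠ 0`, only on `z` and on `2 (xy + yz + zx) - x² - y² - z²`. -/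
lemma eq_of_reflections {φ : ℝ → ℝ → ℝ → ℝ}
    (hpoly : ∀ X Y Z : Polynomial ℝ, ∃ r : Polynomial ℝ, ∀ t,
      φ (X.eval t) (Y.eval t) (Z.eval t) = r.eval t)
    (h₁ : ∀ x y z, φ (2 * y + 2 * z - x) y z = φ x y z)
    (h₂ : ∀ x y z, φ x (2 * x + 2 * z - y) z = φ x y z)
    {x y x' y' z : ℝ} (hz : z ≠ 0)
    (hK : 4 * x * z - (y - x - z) ^ 2 = 4 * x' * z - (y' - x' - z) ^ 2) :
    φ x y z = φ x' y' z := by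
  set k := 4 * x * z - (y - x - z) ^ 2 with hk
  -- For fixed `z ≠ 0` the level set `K = k` is a parabola. With `t = x - y` as parameter, `x + y =
  -- (k + t² + z²) / (2z)`.
  let a : ℝ → ℝ := fun t => ((k + t ^ 2 + z ^ 2) / (2 * z) + t) / 2
  let b : ℝ → ℝ := fun t => ((k + t ^ 2 + z ^ 2) / (2 * z) - t) / 2
  obtain ⟨r, hr⟩ := hpoly
    (Polynomial.C (1 / (4 * z)) * (Polynomial.C (k + z ^ 2) + Polynomial.X ^ 2) +
      Polynomial.C (1 / 2) * Polynomial.X)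
    (Polynomial.C (1 / (4 * z)) * (Polynomial.C (k + z ^ 2) + Polynomial.X ^ 2) -
      Polynomial.C (1 / 2) * Polynomial.X) (Polynomial.C z)
  have hr' : ∀ t, φ (a t) (b t) z = r.eval t := by
    intro t
    rw [← hr t]
    simp only [Polynomial.eval_add, Polynomial.eval_sub, Polynomial.eval_mul, Polynomial.eval_pow,
      Polynomial.eval_C, Polynomial.eval_X]
    congr 1
    · simp only [a]; field_simp; ring
    · simp only [b]; field_simp; ring
  -- The reflections act by `t ↦ 2z - t` and `t ↦ -2z - t`, so their product is a translation by
  -- `4z`.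
  have hper : ∀ t, r.eval (t + 4 * z) = r.eval t := by
    intro t
    rw [← hr', ← hr', ← h₁ (a (t + 4 * z)), ← h₂ _ (b (t + 4 * z))]
    congr 1
    · simp only [a, b]; field_simp; ring
    · simp only [a, b]; field_simp; ring
  have hpoint : ∀ x y, k = 4 * x * z - (y - x - z) ^ 2 → φ x y z = r.eval (x - y) := by
    intro x y hxy
    rw [← hr']
    congr 1
    · simp only [a]; field_simp; linear_combination (-1) * hxy
    · simp only [b]; field_simp; linear_combination (-1) * hxy
  rw [hpoint x y hk, hpoint x' y' hK]
  exact polynomial_eq_of_periodic r (by positivity) hper _ _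

lemma exists_polynomial_eval (f : MvPolynomial (Fin 3) ℝ) (v : Fin 3 → Polynomial ℝ) :
    ∃ r : Polynomial ℝ, ∀ t, eval (fun i => (v i).eval t) f = r.eval t := by
  refine ⟨aeval v f, fun t => ?_⟩
  induction f using MvPolynomial.induction_on with
  | C a => simp
  | add f g hf hg => simp [hf, hg]
  | mul_X f j hf => simp [hf]

/-- A polynomial invariant under the three reflections is a polynomial in the kinetic energy. -/
theorem exists_eq_aeval_kinetic {f : MvPolynomial (Fin 3) ℝ}
    (hf : ∀ i p, eval (Function.update p i (2 * ∑ j, p j - 3 * p i)) f = eval p f) :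
    ∃ g : Polynomial ℝ, f = Polynomial.aeval kinetic g := by
  have r₀ : ∀ x y z, eval ![2 * y + 2 * z - x, y, z] f = eval ![x, y, z] f := by
    intro x y z
    rw [← hf 0 ![x, y, z]]
    congr 2
    ext i; fin_cases i <;> simp [Fin.sum_univ_three]; ring
  have r₁ : ∀ x y z, eval ![x, 2 * x + 2 * z - y, z] f = eval ![x, y, z] f := by
    intro x y z
    rw [← hf 1 ![x, y, z]]
    congr 2
    ext i; fin_cases i <;> simp [Fin.sum_univ_three]; ring
  have r₂ : ∀ x y z, eval ![x, y, 2 * x + 2 * y - z] f = eval ![x, y, z] f := by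
    intro x y z
    rw [← hf 2 ![x, y, z]]
    congr 2
    ext i; fin_cases i <;> simp [Fin.sum_univ_three]; ring
  have hvec : ∀ X Y Z : Polynomial ℝ, ∃ r : Polynomial ℝ, ∀ t,
      eval ![X.eval t, Y.eval t, Z.eval t] f = r.eval t := by
    intro X Y Z
    obtain ⟨r, hr⟩ := exists_polynomial_eval f ![X, Y, Z]
    refine ⟨r, fun t => ?_⟩
    rw [← hr]
    congr 2
    ext i; fin_cases i <;> rfl
  -- points with equal `z`, resp. equal `x`, and equal kinetic energy
  have eqz : ∀ {x y x' y' z : ℝ}, z ≠ 0 →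
      4 * x * z - (y - x - z) ^ 2 = 4 * x' * z - (y' - x' - z) ^ 2 →
      eval ![x, y, z] f = eval ![x', y', z] f := fun hz hK =>
    eq_of_reflections (φ := fun x y z => eval ![x, y, z] f) hvec r₀ r₁ hz hK
  have eqx : ∀ {x y z y' z' : ℝ}, x ≠ 0 →
      4 * z * x - (y - z - x) ^ 2 = 4 * z' * x - (y' - z' - x) ^ 2 →
      eval ![x, y, z] f = eval ![x, y', z'] f := fun hx hK =>
    eq_of_reflections (φ := fun z y x => eval ![x, y, z] f) (fun X Y Z => hvec Z Y X)
      (fun z y x => by rw [← r₂ x y z]; ring_nf) (fun z y x => by rw [← r₁ x y z]; ring_nf) hx hK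
  -- This curve has `x = 1`, `y = 2 + z`, `z = (t + 1)/4`, so `K = 4z - 1 = t` on it. Restricting
  -- `f` to it gives the candidate `g`.
  obtain ⟨g, hg⟩ := hvec 1 (2 + Polynomial.C (1 / 4) * (Polynomial.X + 1))
    (Polynomial.C (1 / 4) * (Polynomial.X + 1))
  refine ⟨g, ?_⟩
  have hKin : ∀ p : Fin 3 → ℝ, eval p kinetic = 4 * p 0 * p 2 - (p 1 - p 0 - p 2) ^ 2 := by
    intro p
    simp only [eval_kinetic, Fin.sum_univ_three]
    ring
  have hon : ∀ p : Fin 3 → ℝ, 0 < p 0 → 0 < p 2 → -1 < eval p kinetic → eval p kinetic < 0 →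
      eval p f = eval p (Polynomial.aeval kinetic g) := by
    intro p h0 h2 hK1 hK0
    have hR : eval p (Polynomial.aeval kinetic g) = g.eval (eval p kinetic) := by
      rw [← Polynomial.coe_aeval_eq_eval, ← MvPolynomial.coe_aeval_eq_eval]
      exact (Polynomial.aeval_algHom_apply (aeval p) kinetic g).symm
    rw [hR, ← hg]
    set k := eval p kinetic with hk
    rw [hKin] at hk
    have hp : p = ![p 0, p 1, p 2] := by ext i; fin_cases i <;> rfl
    simp only [Polynomial.eval_add, Polynomial.eval_mul, Polynomial.eval_C, Polynomial.eval_X,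
      Polynomial.eval_one, Polynomial.eval_ofNat]
    -- A point is moved to the curve in two moves within its level set: at fixed `x` to height `z =
    -- (k + 1)/4`, then at fixed `z` to `x = 1`. The first needs a real root of `s² = 4xz - k`,
    -- ensured by `x > 0` and `-1 < k < 0`; the second needs `z ≠ 0`.
    have hw : 0 ≤ 4 * p 0 * (1 / 4 * (k + 1)) - k := by
      have : 0 < p 0 * (k + 1) := mul_pos h0 (by linarith)
      linarith
    have hsq := Real.sq_sqrt hw
    set s := √(4 * p 0 * (1 / 4 * (k + 1)) - k)
    rw [hp, eqx (x := p 0) (y' := p 0 + 1 / 4 * (k + 1) + s) (z' := 1 / 4 * (k + 1)) h0.ne',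
      eqz (x' := 1) (y' := 2 + 1 / 4 * (k + 1)) (by linarith)]
    · linear_combination (-1) * hsq
    · linear_combination hsq - hk
  have hopen : IsOpen {p : Fin 3 → ℝ | 0 < p 0 ∧ 0 < p 2 ∧ -1 < eval p kinetic ∧
      eval p kinetic < 0} := by
    have hc : Continuous fun p : Fin 3 → ℝ => eval p kinetic := MvPolynomial.continuous_eval _
    exact (isOpen_lt continuous_const (continuous_apply 0)).inter
      ((isOpen_lt continuous_const (continuous_apply 2)).inter
        ((isOpen_lt continuous_const hc).inter (isOpen_lt hc continuous_const)))
  -- The point of the curve with `t = -1/2`.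
  set p₀ : Fin 3 → ℝ := ![1, 17 / 8, 1 / 8]
  have hmem : p₀ ∈ {p : Fin 3 → ℝ | 0 < p 0 ∧ 0 < p 2 ∧ -1 < eval p kinetic ∧
      eval p kinetic < 0} := by
    simp [hKin, p₀]
    norm_num
  obtain ⟨ε, hε, hball⟩ := Metric.isOpen_iff.1 hopen _ hmem
  refine funext_set (fun i => Metric.ball (p₀ i) ε) (fun i => ?_) fun p hp => ?_
  · rw [Real.ball_eq_Ioo]
    exact Set.Ioo_infinite (by linarith)
  · rw [← ball_pi _ hε] at hp
    obtain ⟨h0, h2, h3, h4⟩ := hball hp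
    exact hon p h0 h2 h3 h4

end BirkhoffInt

/-! ### From first integrals to the recurrence -/

namespace BirkhoffInt

open MvPolynomial

/-- On `U × ℝ³`, `F` is the sum of the series `∑_c P_c(p) exp ⟨c, q⟩` with polynomials `P_c` whose
monomials belong to a common finite set; the coefficients of every monomial are summed
separately. -/
def HasExpansionOn (F : Phase 3 → ℝ) (U : Set (Fin 3 → ℝ))
    (P : (Fin 3 → ℝ) → MvPolynomial (Fin 3) ℝ) : Prop :=
  ∃ (M : Finset (Fin 3 →₀ ℕ)) (f : (Fin 3 → ℝ) → MvPolynomial (Fin 3) ℝ),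
    (∀ c, (P c).support ⊆ M) ∧ (∀ q, (f q).support ⊆ M) ∧
    (∀ q ∈ U, ∀ p, F (q, p) = eval p (f q)) ∧
    ∀ q ∈ U, ∀ k, HasSum (fun c => coeff k (P c) * Real.exp (c ⬝ᵥ q)) (coeff k (f q))

lemma linearMap_eq_sum {σ : Type*} {M : Finset (σ →₀ ℕ)} {f : MvPolynomial σ ℝ}
    (hf : f.support ⊆ M) (T : MvPolynomial σ ℝ →ₗ[ℝ] ℝ) :
    T f = ∑ k ∈ M, T (monomial k 1) * coeff k f := by
  conv_lhs => rw [f.as_sum, map_sum]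
  rw [Finset.sum_subset hf fun k _ hk => by rw [notMem_support_iff.1 hk, monomial_zero, map_zero]]
  refine Finset.sum_congr rfl fun k _ => ?_
  rw [← mul_one (coeff k f), ← smul_eq_mul, ← smul_monomial, map_smul, smul_eq_mul, smul_eq_mul,
    mul_one, mul_comm]

/-- Only finitely many monomials occur, so any linear functional passes through the series. It is
used for evaluation at `p` and for evaluation of a momentum derivative. -/
lemma hasSum_linearMap {σ ι : Type*} {M : Finset (σ →₀ ℕ)} {f : MvPolynomial σ ℝ}
    {P : ι → MvPolynomial σ ℝ} {e : ι → ℝ} (hP : ∀ c, (P c).support ⊆ M) (hf : f.support ⊆ M)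
    (h : ∀ k, HasSum (fun c => coeff k (P c) * e c) (coeff k f)) (T : MvPolynomial σ ℝ →ₗ[ℝ] ℝ) :
    HasSum (fun c => T (P c) * e c) (T f) := by
  rw [linearMap_eq_sum hf T]
  refine (hasSum_sum fun k _ => (h k).mul_left (T (monomial k 1))).congr_fun fun c => ?_
  rw [linearMap_eq_sum (hP c) T, Finset.sum_mul]
  simp_rw [mul_assoc]

lemma HasExpansionOn.hasSum {F : Phase 3 → ℝ} {U : Set (Fin 3 → ℝ)}
    {P : (Fin 3 → ℝ) → MvPolynomial (Fin 3) ℝ} (h : HasExpansionOn F U P) {q : Fin 3 → ℝ}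
    (hq : q ∈ U) (p : Fin 3 → ℝ) :
    HasSum (fun c => eval p (P c) * Real.exp (c ⬝ᵥ q)) (F (q, p)) := by
  obtain ⟨M, f, hP, hf, hF, hs⟩ := h
  rw [hF q hq p]
  exact hasSum_linearMap hP (hf q) (hs q hq) (aeval p).toLinearMap

lemma HasExpansionOn.exists_totalDegree_le {F : Phase 3 → ℝ} {U : Set (Fin 3 → ℝ)}
    {P : (Fin 3 → ℝ) → MvPolynomial (Fin 3) ℝ} (h : HasExpansionOn F U P) :
    ∃ l, ∀ c, (P c).totalDegree ≤ l := by
  obtain ⟨M, -, hP, -⟩ := h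
  exact ⟨_, fun c => Finset.sup_mono (hP c)⟩

lemma IsMomentumPolynomialOn.exists_hasExpansionOn {F : Phase 3 → ℝ} {U : Set (Fin 3 → ℝ)}
    (h : IsMomentumPolynomialOn F U) : ∃ P, HasExpansionOn F U P := by
  classical
  obtain ⟨l, a, ha, hF⟩ := h
  have hA : ∀ k, ∃ A : (Fin 3 → ℝ) → ℝ, k ∈ multiIndices 3 l →
      ∀ q ∈ U, HasSum (fun c => A c * Real.exp (c ⬝ᵥ q)) (a k q) := by
    intro k
    by_cases hk : k ∈ multiIndices 3 l
    · obtain ⟨A, hA⟩ := (ha k hk).exists_hasSum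
      exact ⟨A, fun _ => hA⟩
    · exact ⟨0, fun h => absurd h hk⟩
  choose A hA using hA
  let e : (Fin 3 → ℕ) ≃ (Fin 3 →₀ ℕ) := Finsupp.equivFunOnFinite.symm
  have hsupp : ∀ b : (Fin 3 → ℕ) → ℝ,
      (∑ k ∈ multiIndices 3 l, monomial (e k) (b k)).support ⊆ (multiIndices 3 l).image e := by
    intro b
    refine support_sum.trans (Finset.biUnion_subset.2 fun k hk => ?_)
    exact support_monomial_subset.trans
      (Finset.singleton_subset_iff.2 (Finset.mem_image_of_mem e hk))
  refine ⟨fun c => ∑ k ∈ multiIndices 3 l, monomial (e k) (A k c), (multiIndices 3 l).image e,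
    fun q => ∑ k ∈ multiIndices 3 l, monomial (e k) (a k q), fun c => hsupp _, fun q => hsupp _,
    fun q hq p => ?_, fun q hq m => ?_⟩
  · rw [hF q hq p, map_sum]
    refine Finset.sum_congr rfl fun k _ => ?_
    rw [eval_monomial, Finsupp.prod_fintype _ _ fun i => pow_zero _]
    rfl
  · simp only [coeff_sum, coeff_monomial, Finset.sum_mul]
    refine hasSum_sum fun k hk => ?_
    split_ifs
    · exact hA k hk q hq
    · simp

lemma hasDerivAt_fst_line {F : Phase 3 → ℝ} {q p : Fin 3 → ℝ} (h : DifferentiableAt ℝ F (q, p))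
    (v : Fin 3 → ℝ) : HasDerivAt (fun t : ℝ => F (q + t • v, p)) (fderiv ℝ F (q, p) (v, 0)) 0 := by
  have hl : HasDerivAt (fun t : ℝ => ((q + t • v, p) : Phase 3)) (v, 0) 0 := by
    have h1 : HasDerivAt (fun t : ℝ => q + t • v) v 0 := by
      simpa using ((hasDerivAt_id (0 : ℝ)).smul_const v).const_add q
    exact h1.prodMk (hasDerivAt_const (0 : ℝ) p)
  exact HasFDerivAt.comp_hasDerivAt_of_eq (0 : ℝ) h.hasFDerivAt hl (by simp)

lemma hasDerivAt_snd_line {F : Phase 3 → ℝ} {q p : Fin 3 → ℝ} (h : DifferentiableAt ℝ F (q, p))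
    (v : Fin 3 → ℝ) : HasDerivAt (fun t : ℝ => F (q, p + t • v)) (fderiv ℝ F (q, p) (0, v)) 0 := by
  have hl : HasDerivAt (fun t : ℝ => ((q, p + t • v) : Phase 3)) (0, v) 0 := by
    have h1 : HasDerivAt (fun t : ℝ => p + t • v) v 0 := by
      simpa using ((hasDerivAt_id (0 : ℝ)).smul_const v).const_add p
    exact (hasDerivAt_const (0 : ℝ) q).prodMk h1
  exact HasFDerivAt.comp_hasDerivAt_of_eq (0 : ℝ) h.hasFDerivAt hl (by simp)

lemma fderiv_snd_of_eq_eval {F : Phase 3 → ℝ} {q p : Fin 3 → ℝ}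
    (h : DifferentiableAt ℝ F (q, p)) {f : MvPolynomial (Fin 3) ℝ}
    (hf : ∀ p, F (q, p) = eval p f) (i : Fin 3) :
    fderiv ℝ F (q, p) (0, Pi.single i 1) = eval p (pderiv i f) := by
  have h1 := hasDerivAt_snd_line h (Pi.single i 1)
  have h2 := (hasDerivAt_eval_update f p i (p i)).comp_of_eq (0 : ℝ)
    ((hasDerivAt_id (0 : ℝ)).const_add (p i)) (by simp)
  rw [Function.update_eq_self, mul_one] at h2
  refine h1.unique (h2.congr_of_eventuallyEq (.of_forall fun t => ?_))
  simp only [hf, Function.comp, id]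
  congr 2
  ext j
  by_cases hj : j = i
  · subst hj; simp
  · simp [hj]

lemma bianchiHamiltonian_eq (ν q p : Fin 3 → ℝ) :
    bianchiHamiltonian ν (q, p) = eval p kinetic +
      ∑ a, ∑ b, potentialCoeff ν a b * Real.exp (pairExponent a b ⬝ᵥ q) := by
  have h0 : Finset.Ioi (0 : Fin 3) = {1, 2} := by decide
  have h1 : Finset.Ioi (1 : Fin 3) = {2} := by decide
  have h2 : Finset.Ioi (2 : Fin 3) = ∅ := by decide
  have hd : ∀ a b, pairExponent a b ⬝ᵥ q = q a + q b := by
    intro a b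
    simp [pairExponent, add_dotProduct]
  simp only [bianchiHamiltonian, eval_kinetic, hd, Fin.sum_univ_three, h0, h1, h2, potentialCoeff]
  simp
  rw [add_comm (q 1) (q 0), add_comm (q 2) (q 0), add_comm (q 2) (q 1), ← two_mul, ← two_mul,
    ← two_mul]
  ring

lemma differentiable_bianchiHamiltonian (ν : Fin 3 → ℝ) :
    Differentiable ℝ (bianchiHamiltonian ν) := by
  unfold bianchiHamiltonian
  fun_prop

lemma fderiv_bianchiHamiltonian_snd (ν q p : Fin 3 → ℝ) (i : Fin 3) :
    fderiv ℝ (bianchiHamiltonian ν) (q, p) (0, Pi.single i 1) = 2 * (∑ j, p j - 2 * p i) := by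
  rw [fderiv_snd_of_eq_eval (differentiable_bianchiHamiltonian ν _)
    (f := kinetic + C (∑ a, ∑ b, potentialCoeff ν a b * Real.exp (pairExponent a b ⬝ᵥ q)))
    (fun p => by rw [bianchiHamiltonian_eq, map_add, eval_C])]
  rw [map_add, pderiv_C, add_zero, kinetic]
  have h2 : pderiv i (2 : MvPolynomial (Fin 3) ℝ) = 0 := pderiv_C (a := (2 : ℝ))
  fin_cases i <;> simp at h2 <;> simp [Fin.sum_univ_three, pderiv_X, h2] <;> ring

lemma fderiv_bianchiHamiltonian_fst (ν q p : Fin 3 → ℝ) (i : Fin 3) :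
    fderiv ℝ (bianchiHamiltonian ν) (q, p) (Pi.single i 1, 0) =
      ∑ a, ∑ b, potentialCoeff ν a b * pairExponent a b i * Real.exp (pairExponent a b ⬝ᵥ q) := by
  have h1 := hasDerivAt_fst_line (differentiable_bianchiHamiltonian ν (q, p)) (Pi.single i 1)
  simp only [bianchiHamiltonian_eq] at h1
  refine h1.unique (HasDerivAt.const_add _ (HasDerivAt.fun_sum fun a _ =>
    HasDerivAt.fun_sum fun b _ => ?_))
  have h2 : HasDerivAt (fun t : ℝ => pairExponent a b ⬝ᵥ (q + t • Pi.single i 1))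
      (pairExponent a b i) 0 := by
    simpa [dotProduct_add, dotProduct_smul] using
      ((hasDerivAt_id (0 : ℝ)).mul_const (pairExponent a b i)).const_add (pairExponent a b ⬝ᵥ q)
  have h3 := h2.exp.const_mul (potentialCoeff ν a b)
  rw [zero_smul, add_zero] at h3
  refine h3.congr_deriv ?_
  ring

/-- The coefficients of a first integral satisfy the recurrence `IsIntegralFamily`. -/
theorem HasExpansionOn.isIntegralFamily {ν : Fin 3 → ℝ} {F : Phase 3 → ℝ}
    {U : Set (Fin 3 → ℝ)} {P : (Fin 3 → ℝ) → MvPolynomial (Fin 3) ℝ} (hU : IsOpen U)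
    (hne : U.Nonempty) (h : HasExpansionOn F U P)
    (hF : IsFirstIntegralOn (bianchiHamiltonian ν) F (U ×ˢ Set.univ)) : IsIntegralFamily ν P := by
  intro c
  refine MvPolynomial.funext fun p => sub_eq_zero.1 ?_
  -- For fixed `p`, the values of these differences are the exponential coefficients of `{F, H}`.
  rw [← map_sub]
  refine exp_series_coeff_eq_zero hU hne (a := fun c => eval p (2 * lorentzForm c * P c -
    ∑ i, ∑ j, C (potentialCoeff ν i j) *
      (pderiv i (P (c - pairExponent i j)) + pderiv j (P (c - pairExponent i j)))))
    (fun q hq => ?_) c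
  have hdiff : DifferentiableAt ℝ F (q, p) :=
    (hF.1 (q, p) ⟨hq, trivial⟩).differentiableAt
      ((hU.prod isOpen_univ).mem_nhds ⟨hq, trivial⟩)
  have hfst : ∀ i, HasSum (fun c => c i * eval p (P c) * Real.exp (c ⬝ᵥ q))
      (fderiv ℝ F (q, p) (Pi.single i 1, 0)) := by
    intro i
    simpa using hasSum_dotProduct_mul_of_hasDerivAt hU (a := fun c => eval p (P c))
      (g := fun q => F (q, p)) (fun q hq => h.hasSum hq p) hq (Pi.single i 1)
      (hasDerivAt_fst_line hdiff _)
  have hsnd : ∀ i, HasSum (fun c => eval p (pderiv i (P c)) * Real.exp (c ⬝ᵥ q))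
      (fderiv ℝ F (q, p) (0, Pi.single i 1)) := by
    intro i
    obtain ⟨M, f, hP, hf, hFf, hs⟩ := h
    rw [fderiv_snd_of_eq_eval hdiff (hFf q hq)]
    exact hasSum_linearMap hP (hf q) (hs q hq)
      ((aeval p).toLinearMap ∘ₗ (pderiv i).toLinearMap)
  have hkin := hasSum_sum (s := Finset.univ) fun i _ =>
    (hfst i).mul_right (2 * (∑ j, p j - 2 * p i))
  -- Multiplication by `exp(qᵢ + qⱼ)` shifts the index, which produces `c - pairExponent i j`.
  have hpot := hasSum_sum (s := Finset.univ) fun i _ => hasSum_sum (s := Finset.univ) fun j _ =>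
    (Equiv.subRight (pairExponent i j)).hasSum_iff.2
      (((hsnd i).add (hsnd j)).mul_left
        (potentialCoeff ν i j * Real.exp (pairExponent i j ⬝ᵥ q)))
  have hbr := hF.2 (q, p) ⟨hq, trivial⟩
  convert! hkin.sub hpot using 1
  · ext c
    simp only [map_sub, map_mul, map_sum, map_add, eval_C, eval_lorentzForm, map_ofNat,
      Function.comp, Equiv.subRight_apply, sub_mul, Finset.sum_mul, Finset.mul_sum]
    congr 1
    · refine Finset.sum_congr rfl fun i _ => ?_
      ring
    · refine Finset.sum_congr rfl fun i _ => Finset.sum_congr rfl fun j _ => ?_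
      rw [sub_dotProduct, Real.exp_sub]
      field_simp
  · rw [← hbr, poissonBracket]
    simp only [fderiv_bianchiHamiltonian_fst, fderiv_bianchiHamiltonian_snd]
    rw [Finset.sum_sub_distrib]
    congr 1
    simp only [Finset.mul_sum]
    rw [Finset.sum_comm]
    refine Finset.sum_congr rfl fun a _ => ?_
    rw [Finset.sum_comm]
    refine Finset.sum_congr rfl fun b _ => ?_
    simp only [pairExponent, Pi.add_apply, Pi.single_apply, mul_add, add_mul, mul_ite, ite_mul,
      mul_one, mul_zero, zero_mul, Finset.sum_add_distrib, Finset.sum_ite_eq', Finset.mem_univ,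
      if_true]
    ring

end BirkhoffInt

/-! ### Polynomials in the Hamiltonian, and the comparison with a given integral -/

namespace BirkhoffInt

open MvPolynomial

/-- The Hamiltonian as a polynomial in `exp Qᵢ` over the polynomials in the momenta. -/
noncomputable def hamiltonianPolynomial (ν : Fin 3 → ℝ) :
    MvPolynomial (Fin 3) (MvPolynomial (Fin 3) ℝ) :=
  C kinetic + ∑ a, ∑ b, C (C (potentialCoeff ν a b)) * (X a * X b)

/-- The exponent of a monomial in `exp Qᵢ`, as a real vector. -/
def realExponent (m : Fin 3 →₀ ℕ) : Fin 3 → ℝ := fun i => m i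

/-- The substitution `Xᵢ = exp Qᵢ`. -/
noncomputable def evalExp (q : Fin 3 → ℝ) :
    MvPolynomial (Fin 3) (MvPolynomial (Fin 3) ℝ) →+* MvPolynomial (Fin 3) ℝ :=
  eval fun i => C (Real.exp (q i))

lemma evalExp_eq_sum (q : Fin 3 → ℝ) (E : MvPolynomial (Fin 3) (MvPolynomial (Fin 3) ℝ)) :
    evalExp q E = ∑ m ∈ E.support, C (Real.exp (realExponent m ⬝ᵥ q)) * coeff m E := by
  rw [evalExp, eval_eq]
  refine Finset.sum_congr rfl fun m _ => ?_
  rw [mul_comm, Finset.prod_subset (Finset.subset_univ m.support)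
    fun i _ hi => by rw [Finsupp.notMem_support_iff.1 hi, pow_zero]]
  simp only [← C_pow, ← map_prod, ← Real.exp_nat_mul, ← Real.exp_sum]
  rfl

/-- Applied to `g(H)` as a polynomial in the `exp Qᵢ`: its seed is the constant term, found by
dropping the potential, hence `g(K)`. -/
lemma hasExpansionOn_of_polynomial (E : MvPolynomial (Fin 3) (MvPolynomial (Fin 3) ℝ))
    (U : Set (Fin 3 → ℝ)) : ∃ P, P 0 = constantCoeff E ∧
      HasExpansionOn (fun z => eval z.2 (evalExp z.1 E)) U P := by
  classical
  refine ⟨fun c => ∑ m ∈ E.support, if c = realExponent m then coeff m E else 0, ?_,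
    E.support.biUnion fun m => (coeff m E).support, fun q => evalExp q E, fun c => ?_, fun q => ?_,
    fun q _ p => rfl, fun q _ k => ?_⟩
  · have h0 : ∀ m : Fin 3 →₀ ℕ, (0 : Fin 3 → ℝ) = realExponent m ↔ 0 = m := by
      intro m
      constructor
      · intro h
        ext i
        have := congrFun h i
        simp only [realExponent, Pi.zero_apply] at this
        exact_mod_cast this
      · rintro rfl
        ext i
        simp [realExponent]
    simp only [h0, Finset.sum_ite_eq, constantCoeff_eq]
    split_ifs with h
    · rfl
    · exact (notMem_support_iff.1 h).symm
  · refine support_sum.trans (Finset.biUnion_mono fun m _ => ?_)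
    split_ifs <;> simp
  · beta_reduce
    rw [evalExp_eq_sum]
    refine support_sum.trans (Finset.biUnion_mono fun m _ => ?_)
    rw [← smul_eq_C_mul]
    exact support_smul
  · beta_reduce
    rw [evalExp_eq_sum]
    simp only [coeff_sum, Finset.sum_mul, coeff_C_mul]
    refine hasSum_sum fun m _ => ?_
    refine (hasSum_ite_eq (realExponent m) _).congr_fun fun c => ?_
    split_ifs with h
    · rw [h, mul_comm]
    · simp

lemma eval_evalExp_hamiltonianPolynomial (ν q p : Fin 3 → ℝ) :
    eval p (evalExp q (hamiltonianPolynomial ν)) = bianchiHamiltonian ν (q, p) := by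
  rw [bianchiHamiltonian_eq]
  simp [hamiltonianPolynomial, evalExp, pairExponent, add_dotProduct, Real.exp_add]

/-- Polynomials in the Hamiltonian have an expansion. -/
lemma exists_hasExpansionOn_comp_bianchiHamiltonian (ν : Fin 3 → ℝ) (g : Polynomial ℝ)
    (U : Set (Fin 3 → ℝ)) : ∃ P, P 0 = Polynomial.aeval kinetic g ∧
      HasExpansionOn (fun z => g.eval (bianchiHamiltonian ν z)) U P := by
  obtain ⟨P, hP0, hP⟩ :=
    hasExpansionOn_of_polynomial (Polynomial.aeval (hamiltonianPolynomial ν) g) U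
  refine ⟨P, ?_, ?_⟩
  · rw [hP0, Polynomial.aeval_def, Polynomial.hom_eval₂, Polynomial.aeval_def]
    congr 1
    · ext1 r
      rw [RingHom.comp_apply, IsScalarTower.algebraMap_apply ℝ (MvPolynomial (Fin 3) ℝ)]
      exact constantCoeff_C _ _
    · simp [hamiltonianPolynomial]
  · convert! hP using 2 with z
    rw [Polynomial.aeval_def, Polynomial.hom_eval₂, Polynomial.hom_eval₂,
      eval_evalExp_hamiltonianPolynomial, Polynomial.eval]
    congr 1
    exact Subsingleton.elim _ _

lemma hasFDerivAt_comp_bianchiHamiltonian (ν : Fin 3 → ℝ) (g : Polynomial ℝ) (z : Phase 3) :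
    HasFDerivAt (fun z => g.eval (bianchiHamiltonian ν z))
      (g.derivative.eval (bianchiHamiltonian ν z) • fderiv ℝ (bianchiHamiltonian ν) z) z :=
  (g.hasDerivAt _).comp_hasFDerivAt z (differentiable_bianchiHamiltonian ν z).hasFDerivAt

lemma isFirstIntegralOn_comp_bianchiHamiltonian (ν : Fin 3 → ℝ) (g : Polynomial ℝ)
    (D : Set (Phase 3)) :
    IsFirstIntegralOn (bianchiHamiltonian ν) (fun z => g.eval (bianchiHamiltonian ν z)) D := by
  refine ⟨fun z _ =>
    (hasFDerivAt_comp_bianchiHamiltonian ν g z).differentiableAt.differentiableWithinAt,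
    fun z _ => Finset.sum_eq_zero fun i _ => ?_⟩
  rw [(hasFDerivAt_comp_bianchiHamiltonian ν g z).fderiv]
  simp only [smul_apply, smul_eq_mul]
  ring

lemma IsIntegralFamily.sub {ν : Fin 3 → ℝ} {P P' : (Fin 3 → ℝ) → MvPolynomial (Fin 3) ℝ}
    (h : IsIntegralFamily ν P) (h' : IsIntegralFamily ν P') : IsIntegralFamily ν (P - P') := by
  intro c
  simp only [Pi.sub_apply, mul_sub, h c, h' c, ← Finset.sum_sub_distrib, map_sub]
  refine Finset.sum_congr rfl fun i _ => Finset.sum_congr rfl fun j _ => ?_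
  ring

/-- Every first integral that is polynomial in the momenta, with exponential series as
coefficients, is a polynomial in the Hamiltonian. -/
theorem exists_eq_eval_bianchiHamiltonian {ν : Fin 3 → ℝ} (hν : ∀ i, ν i ≠ 0)
    {U : Set (Fin 3 → ℝ)} (hU : IsOpen U) (hne : U.Nonempty) {F : Phase 3 → ℝ}
    (hpoly : IsMomentumPolynomialOn F U)
    (hF : IsFirstIntegralOn (bianchiHamiltonian ν) F (U ×ˢ Set.univ)) :
    ∃ g : Polynomial ℝ, ∀ z ∈ U ×ˢ (Set.univ : Set (Fin 3 → ℝ)),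
      F z = g.eval (bianchiHamiltonian ν z) := by
  obtain ⟨P, hP⟩ := hpoly.exists_hasExpansionOn
  obtain ⟨l, hl⟩ := hP.exists_totalDegree_le
  have hfam := hP.isIntegralFamily hU hne hF
  obtain ⟨g, hg⟩ := exists_eq_aeval_kinetic (hfam.eval_reflection hν hl)
  obtain ⟨P', hP'0, hP'⟩ := exists_hasExpansionOn_comp_bianchiHamiltonian ν g U
  obtain ⟨l', hl'⟩ := hP'.exists_totalDegree_le
  have hfam' := hP'.isIntegralFamily hU hne (isFirstIntegralOn_comp_bianchiHamiltonian ν g _)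
  have hdeg : ∀ c, ((P - P') c).totalDegree ≤ max l l' := fun c =>
    (totalDegree_sub _ _).trans (max_le_max (hl c) (hl' c))
  -- The difference satisfies the recurrence with seed zero, and a nonzero coefficient anywhere
  -- would force a nonzero seed.
  have heq : P = P' := by
    refine sub_eq_zero.1 (funext fun c => ?_)
    by_contra hc
    refine ((hfam.sub hfam').support hdeg hc).1 ?_
    rw [Pi.sub_apply, hg, hP'0, sub_self]
  refine ⟨g, fun z hz => ?_⟩
  have h1 := hP.hasSum hz.1 z.2
  have h2 := hP'.hasSum hz.1 z.2
  rw [heq] at h1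
  exact h1.unique h2

end BirkhoffInt

/-! ### Non-integrability -/

open BirkhoffInt in
theorem theorem1 (ν : Fin 3 → ℝ) (hν : ∀ i, ν i ≠ 0) (U : Set (Fin 3 → ℝ)) (hU : IsOpen U) :
    ¬ BirkhoffInt.BirkhoffIntegrableOn (BirkhoffInt.bianchiHamiltonian ν) U := by
  rintro ⟨F, hF, z, hz, hli⟩
  have hprop : ∀ j, ∃ r : ℝ, fderiv ℝ (F j) z = r • fderiv ℝ (bianchiHamiltonian ν) z := by
    intro j
    obtain ⟨g, hg⟩ := exists_eq_eval_bianchiHamiltonian hν hU ⟨z.1, hz.1⟩ (hF j).1 (hF j).2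
    refine ⟨_, HasFDerivAt.fderiv ((hasFDerivAt_comp_bianchiHamiltonian ν g z).congr_of_eventuallyEq
      ?_)⟩
    filter_upwards [(hU.prod isOpen_univ).mem_nhds hz] with y hy using hg y hy
  choose r hr using hprop
  have hpair : LinearIndependent ℝ ![fderiv ℝ (F 0) z, fderiv ℝ (F 1) z] := by
    convert hli.comp ![0, 1] (by decide) using 1
    ext i : 1
    fin_cases i <;> rfl
  -- With `dFⱼ = rⱼ dH`, the relation `r₁ dF₀ - r₀ dF₁ = 0` forces `r₀ = 0`, hence `dF₀ = 0`.
  have h := LinearIndependent.pair_iff.1 hpair (r 1) (-r 0) (by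
    rw [hr 0, hr 1]
    module)
  refine hli.ne_zero 0 ?_
  rw [hr 0, neg_eq_zero.1 h.2, zero_smul]
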